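/- **Weight schemes.** Let $f:D\to\{0,1\}$ with $D\subseteq\{0,1\}^N$ be a (total or partial) Boolean function. A weight scheme for $f$ consists of sets $X\subseteq f^{-1}(0)$, $Y\subseteq f^{-1}(1)$, a non-empty relation $R\subseteq X\times Y$, and real weights $w(x,y)$, $w'(x,y,i)$, $w'(y,x,i)$ such that for all $(x,y)\in R$ and all $i\in[N]$ with $x(i)\neq y(i)$: $w(x,y)>0$, $w'(x,y,i)>0$, $w'(y,x,i)>0$ and $w'(x,y,i)\,w'(y,x,i)\ge w(x,y)^2$. For $x\in X$ put $wt(x)=\sum_{y:(x,y)\in R}w(x,y)$ and $v(x,i)=\sum_{y:(x,y)\in R,\,x(i)\ne y(i)}w'(x,y,i)$; for $y\in Y$ put $wt(y)=\sum_{x:(x,y)\in R}w(x,y)$ and $v(y,i)=\sum_{x:(x,y)\in R,\,x(i)\neq y(i)}w'(y,x,i)$. Let $v_X=\max_{x\in X,\,i\in[N]}v(x,i)/wt(x)$ and $v_Y=\max_{y\in Y,\,i\in[N]}v(y,i)/wt(y)$ (elements that occur in no pair of $R$ being ignored), and $v_{\max}=\sqrt{v_Xv_Y}$. **Model.** A PDQP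 query algorithm acts on a finite-dimensional quantum register, started in a fixed computational basis state. It runs a fixed sequence of steps; each step applies a unitary that does not depend on the input, then a (possibly empty) partial collapsing measurement in the computational basis, and then either a query, that is the phase oracle $O_x:|i,b\rangle\mapsto(-1)^{x(i)\cdot b}|i,b\rangle$ (identity on the workspace, and on contents of the index register that are not in $[N]$), or a non-collapsing measurement, that is a sample from the computational-basis distribution of the current state, which is left unchanged. The answer is a function of the list of samples from the non-collapsing measurements. $Q$ is the number of query steps and $P$ the number of non-collapsing measurements. The algorithm computes $f$ with error $\varepsilon$ if for every $x\in D$ its answer on $x$ is $f(x)$ with probability at least $1-\varepsilon$. **Theorem.** There is an absolute constant $c>0$ such that for every $N$, every $f$, every weight scheme for $f$, every $0\le\varepsilon<1/2$ and every PDQP query algorithm that computes $f$ with error $\varepsilon$, using $Q$ queries and $P$ non-collapsing measurements, one has $v_{\max}>0$ and $$QP\;\ge\;c\,\frac{1-2\sqrt{\varepsilon(1-\varepsilon)}}{v_{\max}} .$$ In particular $QP=\Omega(1/v_{\max})$ for bounded error, e.g. $\varepsilon=1/3$. -/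

import Mathlib

open scoped Matrix

noncomputable section

namespace PDQP

/-- Inputs `x = (x(0), …, x(N-1))` of a Boolean function. -/
abbrev Input (N : ℕ) : Type := Fin N → Bool

/-! ### Weight schemes -/

/-- A weight scheme for the Boolean function `f` on the domain `D` (`D = Set.univ` for a total
function; values of `f` outside `D` play no role). Here `w' x y i` is `w'(x,y,i)` and `w' y x i`
is `w'(y,x,i)`; a pair of `R` is always written with its `0`-input first. -/
structure WeightScheme {N : ℕ} (D : Set (Input N)) (f : Input N → Bool) where
  X : Finset (Input N)
  Y : Finset (Input N)
  R : Finset (Input N × Input N)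
  w : Input N → Input N → ℝ
  w' : Input N → Input N → Fin N → ℝ
  X_sub : ∀ x ∈ X, x ∈ D ∧ f x = false
  Y_sub : ∀ y ∈ Y, y ∈ D ∧ f y = true
  R_sub : R ⊆ X ×ˢ Y
  w_pos : ∀ x y, (x, y) ∈ R → 0 < w x y
  w'_pos_left : ∀ x y, (x, y) ∈ R → ∀ i, x i ≠ y i → 0 < w' x y i
  w'_pos_right : ∀ x y, (x, y) ∈ R → ∀ i, x i ≠ y i → 0 < w' y x i
  w'_mul : ∀ x y, (x, y) ∈ R → ∀ i, x i ≠ y i → w x y ^ 2 ≤ w' x y i * w' y x i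

namespace WeightScheme

variable {N : ℕ} {D : Set (Input N)} {f : Input N → Bool} (S : WeightScheme D f)

/-- The weight `wt(x)` of `x ∈ X`. -/
def wtX (x : Input N) : ℝ := ∑ y ∈ S.Y with (x, y) ∈ S.R, S.w x y

/-- The weight `wt(y)` of `y ∈ Y`. -/
def wtY (y : Input N) : ℝ := ∑ x ∈ S.X with (x, y) ∈ S.R, S.w x y

/-- The load `v(x,i)` of `x ∈ X`. -/
def loadX (x : Input N) (i : Fin N) : ℝ :=
  ∑ y ∈ S.Y with (x, y) ∈ S.R ∧ x i ≠ y i, S.w' x y i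

/-- The load `v(y,i)` of `y ∈ Y`. -/
def loadY (y : Input N) (i : Fin N) : ℝ :=
  ∑ x ∈ S.X with (x, y) ∈ S.R ∧ x i ≠ y i, S.w' y x i

/-- The maximum `X`-load (a maximum over a finite set; an `x` that occurs in no pair of `R` has
load and weight `0` and contributes `0`). -/
def vX : ℝ := ⨆ p : S.X × Fin N, S.loadX p.1 p.2 / S.wtX p.1

/-- The maximum `Y`-load. -/
def vY : ℝ := ⨆ p : S.Y × Fin N, S.loadY p.1 p.2 / S.wtY p.1

/-- The maximum load `v_max` of the scheme. -/
def vmax : ℝ := √(S.vX * S.vY)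

end WeightScheme

/-! ### Quantum query circuits with non-collapsing measurements -/

/-- One step of a circuit on the space with computational basis `B`: a unitary `U`, then a partial
collapsing measurement in the computational basis, which reveals only `label b` of a basis state
`b` (measuring a set of qubits is the case where `label` reads these qubits; a constant `label` is
the empty measurement), and then either a query or a non-collapsing measurement. -/
structure Step (B : Type) [Fintype B] [DecidableEq B] where
  U : Matrix.unitaryGroup B ℂ
  outcomes : ℕ
  label : B → Fin outcomes
  isQuery : Bool

/-- A query algorithm with non-collapsing measurements for inputs of length `N`, on the space with
computational basis `B` (for `l` qubits, `B = (Fin l → Bool)`). The maps `addr` and `ctrl` read the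
query index `i` and the query bit `b` off a basis state; `addr = none` stands for a content of the
index register that is not an index of the input. The map `output` is the classical
postprocessing of the list of results of the non-collapsing measurements. -/
structure Algorithm (N : ℕ) (B : Type) [Fintype B] [DecidableEq B] where
  init : B
  addr : B → Option (Fin N)
  ctrl : B → Bool
  steps : List (Step B)
  output : List B → Bool

section Run

variable {B : Type} [Fintype B] [DecidableEq B]

/-- The probability that the collapsing measurement of the state `χ` gives the label `n`. -/
def collapseProb {k : ℕ} (label : B → Fin k) (χ : B → ℂ) (n : Fin k) : ℝ :=
  ∑ b with label b = n, ‖χ b‖ ^ 2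

/-- The normalized state after the collapsing measurement of `χ` gave the label `n`. -/
def collapse {k : ℕ} (label : B → Fin k) (χ : B → ℂ) (n : Fin k) : B → ℂ :=
  fun b => if label b = n then χ b / (√(collapseProb label χ n) : ℂ) else 0

variable {N : ℕ}

namespace Algorithm

/-- The phase oracle `O_x : |i,b⟩ ↦ (-1)^{x(i)·b} |i,b⟩`, acting as the identity on the workspace
and on basis states whose index register holds no valid index. -/
def oracle (A : Algorithm N B) (x : Input N) (ψ : B → ℂ) : B → ℂ :=
  fun b => match A.addr b with
    | some i => (if x i && A.ctrl b then -1 else 1) * ψ b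
    | none => ψ b

/-- The joint law of the results of the non-collapsing measurements when the listed steps are run
on input `x` from the state `ψ`: `outProb x steps ψ v` is the probability of the list `v`. A
non-collapsing measurement samples a basis state from the current state, which is kept. -/
def outProb (A : Algorithm N B) (x : Input N) : List (Step B) → (B → ℂ) → List B → ℝ
  | [], _, v => if v = [] then 1 else 0
  | s :: rest, ψ, v =>
    ∑ n : Fin s.outcomes, collapseProb s.label (s.U.1 *ᵥ ψ) n *
      (if s.isQuery then
        outProb A x rest (A.oracle x (collapse s.label (s.U.1 *ᵥ ψ) n)) v
      else
        match v with
        | [] => 0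
        | b :: v' => ‖collapse s.label (s.U.1 *ᵥ ψ) n b‖ ^ 2 *
            outProb A x rest (collapse s.label (s.U.1 *ᵥ ψ) n) v')

/-- The number `Q` of queries. -/
def numQueries (A : Algorithm N B) : ℕ := A.steps.countP (fun s => s.isQuery)

/-- The number `P` of non-collapsing measurements. -/
def numMeasurements (A : Algorithm N B) : ℕ := A.steps.countP (fun s => !s.isQuery)

/-- The probability that the algorithm answers `a` on input `x`. -/
def answerProb (A : Algorithm N B) (x : Input N) (a : Bool) : ℝ :=
  ∑ v : Fin A.numMeasurements → B with A.output (List.ofFn v) = a,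
    A.outProb x A.steps (Pi.single A.init 1) (List.ofFn v)

/-- The algorithm computes `f` on the domain `D` with error probability at most `ε`. -/
def Computes (A : Algorithm N B) (D : Set (Input N)) (f : Input N → Bool) (ε : ℝ) : Prop :=
  ∀ x ∈ D, 1 - ε ≤ A.answerProb x (f x)

end Algorithm

end Run

end PDQP

end

/-! Run the algorithm on $x$ and on $y$, coupling the two runs by giving their collapsing
measurements the same outcomes, branch $n$ carrying the weight $\sqrt{p_nq_n}$. The potential is
$|\langle\varphi,\chi\rangle|^{k+1}$, where $k$ counts the non-collapsing measurements still to
come.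

Unitaries preserve it. A collapse splits the inner product into its branches, so by Jensen the
weighted average of the potential does not drop (`norm_overlap_pow_le_sum`). A sample multiplies the
Bhattacharyya coefficient of the result laws by
$\sum_b|\varphi_b||\chi_b|\ge|\langle\varphi,\chi\rangle|$, which pays for the one power given up.
Only a query loses something: at most $2(k+1)$ times the joint amplitude on indices where $x$ and
$y$ differ. Cauchy–Schwarz over the branches gathers these losses into `diffMass`, a product of
expected masses of the separate runs. Both runs start in the same state, so
$1\le\mathrm{BC}+2(P+1)\cdot$`diffMass` (`norm_overlap_pow_le_bhatt`).

If $f(x)\ne f(y)$, correctness forces $\mathrm{BC}\le2\sqrt{\varepsilon(1-\varepsilon)}$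
(`bhatt_le_of_computes`). Averaging over $R$ with weights $w$, the weighted adversary argument
bounds the mean of `diffMass` by $Q\,v_{\max}$ (`sum_w_mul_sqrt_le`), as each run has total query
mass at most $Q$. Finally $P\ge1$ turns $P+1$ into $2P$. -/

noncomputable section

namespace PDQP

/-! ### State vectors, inner products and collapsing measurements -/

section States

variable {B : Type} [Fintype B]

/-- The inner product of two state vectors. -/
def overlap (φ χ : B → ℂ) : ℂ := ∑ b, star (φ b) * χ b

/-- The squared norm of a state vector. -/
def sqNorm (φ : B → ℂ) : ℝ := ∑ b, ‖φ b‖ ^ 2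

lemma overlap_self (φ : B → ℂ) : overlap φ φ = (sqNorm φ : ℂ) := by
  simp only [overlap, sqNorm, Complex.ofReal_sum]
  refine Finset.sum_congr rfl fun b _ => ?_
  rw [Complex.star_def, ← Complex.normSq_eq_conj_mul_self, Complex.normSq_eq_norm_sq]

lemma overlap_unitary [DecidableEq B] (U : Matrix.unitaryGroup B ℂ) (φ χ : B → ℂ) :
    overlap (U.1 *ᵥ φ) (U.1 *ᵥ χ) = overlap φ χ := by
  change star (U.1 *ᵥ φ) ⬝ᵥ (U.1 *ᵥ χ) = star φ ⬝ᵥ χ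
  have hU : U.1ᴴ * U.1 = 1 := Matrix.mem_unitaryGroup_iff'.1 U.2
  rw [Matrix.star_mulVec, Matrix.dotProduct_mulVec, Matrix.vecMul_vecMul, hU, Matrix.vecMul_one]

lemma sqNorm_unitary [DecidableEq B] (U : Matrix.unitaryGroup B ℂ) (φ : B → ℂ) :
    sqNorm (U.1 *ᵥ φ) = sqNorm φ := by
  have h := overlap_unitary U φ φ
  rw [overlap_self, overlap_self] at h
  exact_mod_cast h

/-- The Bhattacharyya coefficient of the computational-basis distributions of two states. -/
def absOverlap (φ χ : B → ℂ) : ℝ := ∑ b, ‖φ b‖ * ‖χ b‖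

lemma absOverlap_nonneg (φ χ : B → ℂ) : 0 ≤ absOverlap φ χ :=
  Finset.sum_nonneg fun _ _ => by positivity

lemma norm_overlap_le (φ χ : B → ℂ) : ‖overlap φ χ‖ ≤ absOverlap φ χ :=
  (norm_sum_le _ _).trans (by simp [absOverlap])

lemma sum_norm_mul_norm_le {B : Type} (s : Finset B) (φ χ : B → ℂ) :
    ∑ b ∈ s, ‖φ b‖ * ‖χ b‖ ≤ √(∑ b ∈ s, ‖φ b‖ ^ 2) * √(∑ b ∈ s, ‖χ b‖ ^ 2) :=
  Real.sum_mul_le_sqrt_mul_sqrt _ _ _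

lemma absOverlap_le_one {φ χ : B → ℂ} (hφ : sqNorm φ ≤ 1) (hχ : sqNorm χ ≤ 1) :
    absOverlap φ χ ≤ 1 :=
  (sum_norm_mul_norm_le _ φ χ).trans
    (mul_le_one₀ (Real.sqrt_le_one.2 hφ) (Real.sqrt_nonneg _) (Real.sqrt_le_one.2 hχ))

lemma norm_overlap_le_one {φ χ : B → ℂ} (hφ : sqNorm φ ≤ 1) (hχ : sqNorm χ ≤ 1) :
    ‖overlap φ χ‖ ≤ 1 := (norm_overlap_le φ χ).trans (absOverlap_le_one hφ hχ)

section Collapse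

variable {k : ℕ} (label : B → Fin k)

lemma collapseProb_nonneg (χ : B → ℂ) (n : Fin k) : 0 ≤ collapseProb label χ n :=
  Finset.sum_nonneg fun _ _ => by positivity

lemma sum_collapseProb (χ : B → ℂ) : ∑ n, collapseProb label χ n = sqNorm χ := by
  simp only [collapseProb, sqNorm]
  exact Finset.sum_fiberwise _ _ _

/-- Undoes the normalization even for an outcome of probability zero, where division by zero gives
the zero vector: there every amplitude with that label vanishes. -/
lemma sqrt_mul_collapse (χ : B → ℂ) (n : Fin k) (b : B) :
    (√(collapseProb label χ n) : ℂ) * collapse label χ n b = if label b = n then χ b else 0 := by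
  unfold collapse
  split_ifs with hb
  · by_cases h : collapseProb label χ n = 0
    · have h0 := (Finset.sum_eq_zero_iff_of_nonneg (fun _ _ => by positivity)).1 h b (by simp [hb])
      have : χ b = 0 := by simpa using h0
      simp [this]
    · have h1 : (√(collapseProb label χ n) : ℂ) ≠ 0 := by
        rw [Complex.ofReal_ne_zero]
        exact (Real.sqrt_pos.2 ((collapseProb_nonneg label χ n).lt_of_ne' h)).ne'
      field_simp
  · simp

/-- The squared norm is $p/p$, which is $0$ for an impossible outcome. This is why states are only
required to have norm at most $1$ throughout. -/
lemma sqNorm_collapse_le (χ : B → ℂ) (n : Fin k) : sqNorm (collapse label χ n) ≤ 1 := by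
  have hp := collapseProb_nonneg label χ n
  have h : sqNorm (collapse label χ n) = collapseProb label χ n / collapseProb label χ n := by
    have hs : collapseProb label χ n = ∑ b, if label b = n then ‖χ b‖ ^ 2 else 0 :=
      Finset.sum_filter _ _
    conv_rhs => rw [hs, Finset.sum_div, ← hs]
    refine Finset.sum_congr rfl fun b _ => ?_
    unfold collapse
    split_ifs
    · rw [norm_div, div_pow, Complex.norm_real, Real.norm_eq_abs, sq_abs, Real.sq_sqrt hp]
    · simp
  rw [h]
  exact div_self_le_one _

lemma sum_sqrt_mul_overlap_collapse (φ χ : B → ℂ) :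
    ∑ n, ((√(collapseProb label φ n) * √(collapseProb label χ n) : ℝ) : ℂ) *
      overlap (collapse label φ n) (collapse label χ n) = overlap φ χ := by
  have h : ∀ n, ((√(collapseProb label φ n) * √(collapseProb label χ n) : ℝ) : ℂ) *
      overlap (collapse label φ n) (collapse label χ n) =
      ∑ b with label b = n, star (φ b) * χ b := by
    intro n
    rw [overlap, Finset.mul_sum, Finset.sum_filter]
    refine Finset.sum_congr rfl fun b _ => ?_
    calc _ = star ((√(collapseProb label φ n) : ℂ) * collapse label φ n b) *
          ((√(collapseProb label χ n) : ℂ) * collapse label χ n b) := by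
          simp only [star_mul', Complex.star_def, Complex.conj_ofReal, Complex.ofReal_mul]; ring
      _ = _ := by
          rw [sqrt_mul_collapse, sqrt_mul_collapse]; split_ifs <;> simp
  rw [Finset.sum_congr rfl fun n _ => h n]
  exact Finset.sum_fiberwise _ _ _

end Collapse

end States

/-! ### Elementary inequalities -/

section Inequalities

/-- Jensen's inequality for powers, with weights of sum at most `1`. -/
lemma pow_sum_mul_le_sum_mul_pow {ι : Type*} [Fintype ι] (r z : ι → ℝ) (hr : ∀ n, 0 ≤ r n)
    (hr1 : ∑ n, r n ≤ 1) (hz : ∀ n, 0 ≤ z n) {m : ℕ} (hm : m ≠ 0) :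
    (∑ n, r n * z n) ^ m ≤ ∑ n, r n * z n ^ m := by
  -- The extra point `none` takes the missing weight $1-\sum r_n$ at the value $0$; it contributes
  -- nothing to the right-hand side because $0^m=0$ for $m\ne0$.
  have h := Real.pow_arith_mean_le_arith_mean_pow (Finset.univ : Finset (Option ι))
    (fun o => o.elim (1 - ∑ n, r n) r) (fun o => o.elim 0 z)
    (fun o _ => by cases o <;> simp [hr, hr1]) (by simp [Fintype.sum_option])
    (fun o _ => by cases o <;> simp [hz]) m
  simpa [Fintype.sum_option, hm] using h

lemma pow_le_pow_add_mul {a b d : ℝ} (ha0 : 0 ≤ a) (ha : a ≤ 1) (hb0 : 0 ≤ b) (hb : b ≤ 1)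
    (hd : 0 ≤ d) (h : a ≤ b + d) (m : ℕ) : a ^ m ≤ b ^ m + m * d := by
  induction m with
  | zero => simp
  | succ m ih =>
    have hbm : b ^ m ≤ 1 := pow_le_one₀ hb0 hb
    have hb' : 0 ≤ b ^ m := pow_nonneg hb0 m
    calc a ^ (m + 1) = a ^ m * a := pow_succ a m
      _ ≤ (b ^ m + m * d) * a := by gcongr
      _ = b ^ m * a + m * d * a := by ring
      _ ≤ b ^ m * (b + d) + m * d * 1 := by gcongr
      _ = b ^ (m + 1) + b ^ m * d + m * d := by ring
      _ ≤ b ^ (m + 1) + 1 * d + m * d := by gcongr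
      _ = _ := by push_cast; ring

lemma sqrt_mul_sqrt_add_le {a b c d : ℝ} (ha : 0 ≤ a) (hb : 0 ≤ b) (hc : 0 ≤ c) (hd : 0 ≤ d) :
    √a * √b + √c * √d ≤ √(a + c) * √(b + d) := by
  have h := Real.sum_sqrt_mul_sqrt_le (Finset.univ : Finset (Fin 2)) (f := ![a, c]) (g := ![b, d])
    (fun i => by fin_cases i <;> simpa) (fun i => by fin_cases i <;> simpa)
  simpa using h

end Inequalities

/-! ### The oracle and the query mass -/

namespace Algorithm

variable {B : Type} [Fintype B] [DecidableEq B] {N : ℕ} (A : Algorithm N B)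

lemma norm_oracle (x : Input N) (ψ : B → ℂ) (b : B) : ‖A.oracle x ψ b‖ = ‖ψ b‖ := by
  unfold oracle
  split
  · split_ifs <;> simp
  · rfl

lemma sqNorm_oracle (x : Input N) (ψ : B → ℂ) : sqNorm (A.oracle x ψ) = sqNorm ψ := by
  simp only [sqNorm, norm_oracle]

/-- The squared amplitude of `ψ` on the basis states that query the index `i`. -/
def addrMass (ψ : B → ℂ) (i : Fin N) : ℝ := ∑ b with A.addr b = some i, ‖ψ b‖ ^ 2

lemma addrMass_nonneg (ψ : B → ℂ) (i : Fin N) : 0 ≤ A.addrMass ψ i :=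
  Finset.sum_nonneg fun _ _ => by positivity

lemma sum_addrMass_le (ψ : B → ℂ) : ∑ i, A.addrMass ψ i ≤ sqNorm ψ := by
  have h : ∑ o : Option (Fin N), ∑ b with A.addr b = o, ‖ψ b‖ ^ 2 = sqNorm ψ :=
    Finset.sum_fiberwise _ _ _
  rw [Fintype.sum_option] at h
  rw [← h]
  exact le_add_of_nonneg_left (Finset.sum_nonneg fun _ _ => by positivity)

/-- A pair of oracles changes the inner product only through the indices where the inputs differ. -/
lemma norm_overlap_le_oracle (x y : Input N) (φ χ : B → ℂ) :
    ‖overlap φ χ‖ ≤ ‖overlap (A.oracle x φ) (A.oracle y χ)‖ +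
      2 * ∑ i with x i ≠ y i, √(A.addrMass φ i) * √(A.addrMass χ i) := by
  have hterm : ∀ b, ‖star (φ b) * χ b - star (A.oracle x φ b) * A.oracle y χ b‖ ≤
      2 * ∑ i with x i ≠ y i, if A.addr b = some i then ‖φ b‖ * ‖χ b‖ else 0 := by
    intro b
    unfold oracle
    cases hb : A.addr b with
    | none => simp
    | some i =>
      by_cases hi : x i = y i
      · have h0 : star (φ b) * χ b - star ((if x i && A.ctrl b then -1 else 1) * φ b) *
            ((if y i && A.ctrl b then -1 else 1) * χ b) = 0 := by
          rw [hi]; split_ifs <;> simp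
        rw [h0, norm_zero]
        exact mul_nonneg zero_le_two (Finset.sum_nonneg fun _ _ => by positivity)
      · have h1 : (∑ j with x j ≠ y j, if (some i : Option (Fin N)) = some j then
            ‖φ b‖ * ‖χ b‖ else 0) = ‖φ b‖ * ‖χ b‖ := by
          simp only [Option.some.injEq]
          rw [Finset.sum_ite_eq, if_pos (by simpa using hi)]
        rw [h1]
        -- The phases may be opposite, so both terms count in full; this is the source of the factor
        -- $2$.
        refine (norm_sub_le _ _).trans_eq ?_
        have h2 : ∀ c : Bool, ‖(if c = true then (-1 : ℂ) else 1)‖ = 1 := by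
          intro c; split_ifs <;> simp
        simp only [norm_mul, norm_star, h2]
        ring
  have hsub : ‖overlap φ χ - overlap (A.oracle x φ) (A.oracle y χ)‖ ≤
      2 * ∑ i with x i ≠ y i, √(A.addrMass φ i) * √(A.addrMass χ i) := by
    simp only [overlap]
    rw [← Finset.sum_sub_distrib]
    refine (norm_sum_le_of_le _ fun b _ => hterm b).trans ?_
    rw [← Finset.mul_sum, Finset.sum_comm]
    refine mul_le_mul_of_nonneg_left (Finset.sum_le_sum fun i _ => ?_) zero_le_two
    rw [← Finset.sum_filter]
    exact sum_norm_mul_norm_le _ _ _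
  have := norm_le_norm_add_norm_sub' (overlap φ χ) (overlap (A.oracle x φ) (A.oracle y χ))
  linarith

/-- The expected squared amplitude on the index `i`, summed over all queries of the listed steps. -/
def queryMass (x : Input N) (i : Fin N) : List (Step B) → (B → ℂ) → ℝ
  | [], _ => 0
  | s :: rest, ψ =>
    ∑ n : Fin s.outcomes, collapseProb s.label (s.U.1 *ᵥ ψ) n *
      (if s.isQuery then
        A.addrMass (collapse s.label (s.U.1 *ᵥ ψ) n) i +
          queryMass x i rest (A.oracle x (collapse s.label (s.U.1 *ᵥ ψ) n))
      else queryMass x i rest (collapse s.label (s.U.1 *ᵥ ψ) n))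

lemma queryMass_nonneg (x : Input N) (i : Fin N) (l : List (Step B)) (ψ : B → ℂ) :
    0 ≤ A.queryMass x i l ψ := by
  induction l generalizing ψ with
  | nil => simp [queryMass]
  | cons s rest ih =>
    refine Finset.sum_nonneg fun n _ => mul_nonneg (collapseProb_nonneg _ _ _) ?_
    split_ifs
    · exact add_nonneg (A.addrMass_nonneg _ _) (ih _)
    · exact ih _

lemma sum_collapseProb_unitary_le_one (s : Step B) {ψ : B → ℂ} (hψ : sqNorm ψ ≤ 1) :
    ∑ n, collapseProb s.label (s.U.1 *ᵥ ψ) n ≤ 1 := by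
  rwa [sum_collapseProb, sqNorm_unitary]

lemma sum_queryMass_le (x : Input N) (l : List (Step B)) (ψ : B → ℂ) (hψ : sqNorm ψ ≤ 1) :
    ∑ i, A.queryMass x i l ψ ≤ (l.countP fun s => s.isQuery : ℕ) := by
  induction l generalizing ψ with
  | nil => simp [queryMass]
  | cons s rest ih =>
    simp only [queryMass]
    rw [Finset.sum_comm]
    set c : ℝ := (((s :: rest).countP fun s => s.isQuery : ℕ) : ℝ) with hc
    have hc0 : 0 ≤ c := Nat.cast_nonneg _
    have hstep : ∀ n : Fin s.outcomes, ∑ i, collapseProb s.label (s.U.1 *ᵥ ψ) n *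
        (if s.isQuery then
          A.addrMass (collapse s.label (s.U.1 *ᵥ ψ) n) i +
            A.queryMass x i rest (A.oracle x (collapse s.label (s.U.1 *ᵥ ψ) n))
        else A.queryMass x i rest (collapse s.label (s.U.1 *ᵥ ψ) n)) ≤
        collapseProb s.label (s.U.1 *ᵥ ψ) n * c := by
      intro n
      rw [← Finset.mul_sum]
      refine mul_le_mul_of_nonneg_left ?_ (collapseProb_nonneg _ _ _)
      have hn := sqNorm_collapse_le s.label (s.U.1 *ᵥ ψ) n
      cases hs : s.isQuery
      · simpa [hc, hs] using ih _ hn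
      · have h1 := ih _ ((A.sqNorm_oracle x _).trans_le hn)
        have h2 := (A.sum_addrMass_le (collapse s.label (s.U.1 *ᵥ ψ) n)).trans hn
        simp only [if_true, Finset.sum_add_distrib, hc, List.countP_cons, hs]
        push_cast
        linarith
    refine (Finset.sum_le_sum fun n _ => hstep n).trans ?_
    rw [← Finset.sum_mul]
    exact mul_le_of_le_one_left hc0 (sum_collapseProb_unitary_le_one s hψ)

/-! ### Laws of the measurement results and their Bhattacharyya coefficients -/

lemma outProb_nonneg (x : Input N) (l : List (Step B)) (ψ : B → ℂ) (v : List B) :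
    0 ≤ A.outProb x l ψ v := by
  induction l generalizing ψ v with
  | nil => unfold outProb; split_ifs <;> simp
  | cons s rest ih =>
    refine Finset.sum_nonneg fun n _ => mul_nonneg (collapseProb_nonneg _ _ _) ?_
    split_ifs
    · exact ih _ _
    · cases v with
      | nil => exact le_rfl
      | cons b v => exact mul_nonneg (by positivity) (ih _ _)

lemma sum_ofFn_succ {B : Type} [Fintype B] {k : ℕ} (g : List B → ℝ) :
    ∑ v : Fin (k + 1) → B, g (List.ofFn v) = ∑ b, ∑ v : Fin k → B, g (b :: List.ofFn v) := by
  rw [← (Fin.consEquiv fun _ => B).sum_comp, Fintype.sum_prod_type]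
  simp [Fin.consEquiv]

lemma sum_outProb_le_one (x : Input N) (l : List (Step B)) (k : ℕ)
    (hk : l.countP (fun s => !s.isQuery) = k) (ψ : B → ℂ) (hψ : sqNorm ψ ≤ 1) :
    ∑ v : Fin k → B, A.outProb x l ψ (List.ofFn v) ≤ 1 := by
  induction l generalizing ψ k with
  | nil =>
    obtain rfl : 0 = k := by simpa using hk
    simp [outProb]
  | cons s rest ih =>
    have hn := sqNorm_collapse_le s.label (s.U.1 *ᵥ ψ)
    -- `t n` is the total mass of the result law conditional on the outcome `n` of the collapse.
    suffices h : ∃ t : Fin s.outcomes → ℝ, (∀ n, t n ≤ 1) ∧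
        ∑ v : Fin k → B, A.outProb x (s :: rest) ψ (List.ofFn v) =
          ∑ n, collapseProb s.label (s.U.1 *ᵥ ψ) n * t n by
      obtain ⟨t, ht, h⟩ := h
      rw [h]
      exact le_trans (Finset.sum_le_sum fun n _ =>
        mul_le_of_le_one_right (collapseProb_nonneg _ _ _) (ht n))
        (sum_collapseProb_unitary_le_one s hψ)
    cases hs : s.isQuery
    · obtain ⟨j, rfl⟩ : ∃ j, k = j + 1 := ⟨_, by rw [← hk, List.countP_cons, hs]; rfl⟩
      refine ⟨fun n => ∑ b, ‖collapse s.label (s.U.1 *ᵥ ψ) n b‖ ^ 2 * ∑ v : Fin j → B,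
        A.outProb x rest (collapse s.label (s.U.1 *ᵥ ψ) n) (List.ofFn v), fun n => ?_, ?_⟩
      · refine le_trans (Finset.sum_le_sum fun b _ => ?_) (hn n)
        exact mul_le_of_le_one_right (by positivity)
          (ih j (by simpa [List.countP_cons, hs] using hk) _ (hn n))
      · rw [sum_ofFn_succ]
        simp only [outProb, hs, Bool.false_eq_true, if_false, Finset.mul_sum]
        conv_rhs => rw [Finset.sum_comm]
        exact Finset.sum_congr rfl fun b _ => Finset.sum_comm
    · refine ⟨fun n => ∑ v : Fin k → B, A.outProb x rest
        (A.oracle x (collapse s.label (s.U.1 *ᵥ ψ) n)) (List.ofFn v), fun n => ?_, ?_⟩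
      · exact ih k (by simpa [List.countP_cons, hs] using hk) _
          ((A.sqNorm_oracle x _).trans_le (hn n))
      · simp only [outProb, hs, if_true, Finset.mul_sum]
        exact Finset.sum_comm

/-- The Bhattacharyya coefficient of the laws of the results of `k` non-collapsing measurements. -/
def bhatt (x y : Input N) (l : List (Step B)) (k : ℕ) (φ χ : B → ℂ) : ℝ :=
  ∑ v : Fin k → B, √(A.outProb x l φ (List.ofFn v)) * √(A.outProb y l χ (List.ofFn v))

/-- Each result law is a mixture over the hidden outcome $n$, and forgetting $n$ can only increase
the Bhattacharyya coefficient, by Cauchy–Schwarz over $n$. -/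
lemma bhatt_cons_query (x y : Input N) (s : Step B) (hs : s.isQuery = true) (rest : List (Step B))
    (k : ℕ) (φ χ : B → ℂ) :
    ∑ n, √(collapseProb s.label (s.U.1 *ᵥ φ) n) * √(collapseProb s.label (s.U.1 *ᵥ χ) n) *
      A.bhatt x y rest k (A.oracle x (collapse s.label (s.U.1 *ᵥ φ) n))
        (A.oracle y (collapse s.label (s.U.1 *ᵥ χ) n)) ≤ A.bhatt x y (s :: rest) k φ χ := by
  simp only [bhatt, Finset.mul_sum, outProb, hs, if_true]
  rw [Finset.sum_comm]
  refine Finset.sum_le_sum fun v _ => le_trans (le_of_eq ?_) (Real.sum_sqrt_mul_sqrt_le _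
    (fun n => mul_nonneg (collapseProb_nonneg _ _ _) (A.outProb_nonneg _ _ _ _))
    (fun n => mul_nonneg (collapseProb_nonneg _ _ _) (A.outProb_nonneg _ _ _ _)))
  refine Finset.sum_congr rfl fun n _ => ?_
  rw [Real.sqrt_mul (collapseProb_nonneg _ _ _), Real.sqrt_mul (collapseProb_nonneg _ _ _)]
  ring

/-- As for a query, but within each branch the sample is independent of the later results, since the
state is kept; the coefficient of a product of laws factors. -/
lemma bhatt_cons_sample (x y : Input N) (s : Step B) (hs : s.isQuery = false)
    (rest : List (Step B)) (k : ℕ) (φ χ : B → ℂ) :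
    ∑ n, √(collapseProb s.label (s.U.1 *ᵥ φ) n) * √(collapseProb s.label (s.U.1 *ᵥ χ) n) *
      (absOverlap (collapse s.label (s.U.1 *ᵥ φ) n) (collapse s.label (s.U.1 *ᵥ χ) n) *
      A.bhatt x y rest k (collapse s.label (s.U.1 *ᵥ φ) n) (collapse s.label (s.U.1 *ᵥ χ) n)) ≤
      A.bhatt x y (s :: rest) (k + 1) φ χ := by
  have hr : A.bhatt x y (s :: rest) (k + 1) φ χ = ∑ b, ∑ v : Fin k → B,
      √(A.outProb x (s :: rest) φ (b :: List.ofFn v)) *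
        √(A.outProb y (s :: rest) χ (b :: List.ofFn v)) :=
    sum_ofFn_succ fun v => √(A.outProb x (s :: rest) φ v) * √(A.outProb y (s :: rest) χ v)
  rw [hr]
  simp only [bhatt, absOverlap, Finset.sum_mul_sum]
  simp only [Finset.mul_sum, outProb, hs, Bool.false_eq_true, if_false]
  rw [Finset.sum_comm]
  refine Finset.sum_le_sum fun b _ => ?_
  rw [Finset.sum_comm]
  have h0 : ∀ (z : Input N) (ψ : B → ℂ) (n : Fin s.outcomes) (v : List B),
      0 ≤ ‖collapse s.label (s.U.1 *ᵥ ψ) n b‖ ^ 2 *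
        A.outProb z rest (collapse s.label (s.U.1 *ᵥ ψ) n) v :=
    fun z ψ n v => mul_nonneg (by positivity) (A.outProb_nonneg _ _ _ _)
  refine Finset.sum_le_sum fun v _ => le_trans (le_of_eq ?_) (Real.sum_sqrt_mul_sqrt_le _
    (fun n => mul_nonneg (collapseProb_nonneg _ _ _) (h0 _ _ _ _))
    (fun n => mul_nonneg (collapseProb_nonneg _ _ _) (h0 _ _ _ _)))
  refine Finset.sum_congr rfl fun n _ => ?_
  rw [Real.sqrt_mul (collapseProb_nonneg _ _ _), Real.sqrt_mul (collapseProb_nonneg _ _ _),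
    Real.sqrt_mul (by positivity), Real.sqrt_mul (by positivity),
    Real.sqrt_sq (norm_nonneg _), Real.sqrt_sq (norm_nonneg _)]
  ring

/-! ### Joint query mass and the decay of the inner product -/

/-- The joint query mass of two runs on the indices where the two inputs differ. -/
def diffMass (x y : Input N) (l : List (Step B)) (φ χ : B → ℂ) : ℝ :=
  ∑ i with x i ≠ y i, √(A.queryMass x i l φ) * √(A.queryMass y i l χ)

lemma diffMass_nonneg (x y : Input N) (l : List (Step B)) (φ χ : B → ℂ) :
    0 ≤ A.diffMass x y l φ χ := Finset.sum_nonneg fun _ _ => by positivity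

/-- Two uses of Cauchy–Schwarz, first merging the current query with the later ones and then merging
the branches, separate the coupled mass into the expected masses of the two runs. -/
lemma diffMass_cons_query (x y : Input N) (s : Step B) (hs : s.isQuery = true)
    (rest : List (Step B)) (φ χ : B → ℂ) :
    ∑ n, √(collapseProb s.label (s.U.1 *ᵥ φ) n) * √(collapseProb s.label (s.U.1 *ᵥ χ) n) *
      (∑ i with x i ≠ y i, √(A.addrMass (collapse s.label (s.U.1 *ᵥ φ) n) i) *
          √(A.addrMass (collapse s.label (s.U.1 *ᵥ χ) n) i) +
        A.diffMass x y rest (A.oracle x (collapse s.label (s.U.1 *ᵥ φ) n))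
          (A.oracle y (collapse s.label (s.U.1 *ᵥ χ) n))) ≤ A.diffMass x y (s :: rest) φ χ := by
  simp only [diffMass, ← Finset.sum_add_distrib, Finset.mul_sum, queryMass, hs, if_true]
  rw [Finset.sum_comm]
  refine Finset.sum_le_sum fun i _ => ?_
  have h0 : ∀ (z : Input N) (ψ ψ' : B → ℂ), 0 ≤ A.addrMass ψ i + A.queryMass z i rest ψ' :=
    fun z ψ ψ' => add_nonneg (A.addrMass_nonneg _ _) (A.queryMass_nonneg _ _ _ _)
  refine le_trans (Finset.sum_le_sum fun n _ => ?_) (Real.sum_sqrt_mul_sqrt_le _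
    (fun n => mul_nonneg (collapseProb_nonneg _ _ _) (h0 _ _ _))
    (fun n => mul_nonneg (collapseProb_nonneg _ _ _) (h0 _ _ _)))
  rw [Real.sqrt_mul (collapseProb_nonneg _ _ _), Real.sqrt_mul (collapseProb_nonneg _ _ _),
    mul_mul_mul_comm]
  exact mul_le_mul_of_nonneg_left (sqrt_mul_sqrt_add_le (A.addrMass_nonneg _ _)
    (A.addrMass_nonneg _ _) (A.queryMass_nonneg _ _ _ _) (A.queryMass_nonneg _ _ _ _))
    (by positivity)

lemma diffMass_cons_sample (x y : Input N) (s : Step B) (hs : s.isQuery = false)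
    (rest : List (Step B)) (φ χ : B → ℂ) :
    ∑ n, √(collapseProb s.label (s.U.1 *ᵥ φ) n) * √(collapseProb s.label (s.U.1 *ᵥ χ) n) *
      A.diffMass x y rest (collapse s.label (s.U.1 *ᵥ φ) n)
          (collapse s.label (s.U.1 *ᵥ χ) n) ≤ A.diffMass x y (s :: rest) φ χ := by
  simp only [diffMass, Finset.mul_sum, queryMass, hs, Bool.false_eq_true, if_false]
  rw [Finset.sum_comm]
  refine Finset.sum_le_sum fun i _ => ?_
  refine le_trans (Finset.sum_le_sum fun n _ => ?_) (Real.sum_sqrt_mul_sqrt_le _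
    (fun n => mul_nonneg (collapseProb_nonneg _ _ _) (A.queryMass_nonneg _ _ _ _))
    (fun n => mul_nonneg (collapseProb_nonneg _ _ _) (A.queryMass_nonneg _ _ _ _)))
  rw [Real.sqrt_mul (collapseProb_nonneg _ _ _), Real.sqrt_mul (collapseProb_nonneg _ _ _),
    mul_mul_mul_comm]

/-- Collapsing measurements do not decrease the expected power of the inner product. -/
lemma norm_overlap_pow_le_sum (s : Step B) {φ χ : B → ℂ} (hφ : sqNorm φ ≤ 1) (hχ : sqNorm χ ≤ 1)
    {m : ℕ} (hm : m ≠ 0) :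
    ‖overlap φ χ‖ ^ m ≤
      ∑ n, √(collapseProb s.label (s.U.1 *ᵥ φ) n) * √(collapseProb s.label (s.U.1 *ᵥ χ) n) *
        ‖overlap (collapse s.label (s.U.1 *ᵥ φ) n) (collapse s.label (s.U.1 *ᵥ χ) n)‖ ^ m := by
  refine le_trans ?_ (pow_sum_mul_le_sum_mul_pow _ _ (fun n => by positivity) ?_
    (fun n => norm_nonneg _) hm)
  · gcongr
    rw [← overlap_unitary s.U, ← sum_sqrt_mul_overlap_collapse s.label]
    refine norm_sum_le_of_le _ fun n _ => ?_
    rw [norm_mul, Complex.norm_real, Real.norm_of_nonneg (by positivity)]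
  · refine (Real.sum_sqrt_mul_sqrt_le _ (collapseProb_nonneg _ _) (collapseProb_nonneg _ _)).trans ?_
    exact mul_le_one₀ (Real.sqrt_le_one.2 (sum_collapseProb_unitary_le_one s hφ))
      (Real.sqrt_nonneg _) (Real.sqrt_le_one.2 (sum_collapseProb_unitary_le_one s hχ))

/-- Few non-collapsing measurements and little query mass on the distinguishing indices leave the
laws of the results close to each other. -/
lemma norm_overlap_pow_le_bhatt (x y : Input N) (l : List (Step B)) (k : ℕ)
    (hk : l.countP (fun s => !s.isQuery) = k) (φ χ : B → ℂ) (hφ : sqNorm φ ≤ 1)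
    (hχ : sqNorm χ ≤ 1) (C : ℝ) (hC : 2 * ((k : ℝ) + 1) ≤ C) :
    ‖overlap φ χ‖ ^ (k + 1) ≤ A.bhatt x y l k φ χ + C * A.diffMass x y l φ χ := by
  have hC0 : 0 ≤ C := le_trans (by positivity) hC
  induction l generalizing φ χ k with
  | nil =>
    obtain rfl : 0 = k := by simpa using hk
    simpa [bhatt, diffMass, outProb, queryMass] using norm_overlap_le_one hφ hχ
  | cons s rest ih =>
    -- Jensen with weights of sum below $1$ needs a positive exponent; the spare power in $k+1$
    -- ensures this when no samples remain.
    refine (norm_overlap_pow_le_sum (m := k + 1) s hφ hχ k.succ_ne_zero).trans ?_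
    have hφn := sqNorm_collapse_le s.label (s.U.1 *ᵥ φ)
    have hχn := sqNorm_collapse_le s.label (s.U.1 *ᵥ χ)
    cases hs : s.isQuery
    · obtain ⟨j, rfl⟩ : ∃ j, k = j + 1 := ⟨_, by rw [← hk, List.countP_cons, hs]; rfl⟩
      have hj : rest.countP (fun s => !s.isQuery) = j := by
        simpa [List.countP_cons, hs] using hk
      refine le_trans ?_ (add_le_add (A.bhatt_cons_sample x y s hs rest j φ χ)
        (mul_le_mul_of_nonneg_left (A.diffMass_cons_sample x y s hs rest φ χ) hC0))
      rw [Finset.mul_sum, ← Finset.sum_add_distrib]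
      refine Finset.sum_le_sum fun n _ => ?_
      rw [mul_left_comm C, ← mul_add]
      refine mul_le_mul_of_nonneg_left ?_ (by positivity)
      have h := ih j hj _ _ (hφn n) (hχn n) (by push_cast at hC; linarith)
      have hβ := absOverlap_nonneg (collapse s.label (s.U.1 *ᵥ φ) n)
        (collapse s.label (s.U.1 *ᵥ χ) n)
      -- One power pays for the sample; the other $j+1$ are the potential of the rest. In the error
      -- term the factor `absOverlap`, at most $1$, is dropped.
      rw [pow_succ']
      refine (mul_le_mul (norm_overlap_le _ _) h (by positivity) hβ).trans ?_
      rw [mul_add]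
      refine add_le_add_right ?_ _
      exact mul_le_of_le_one_left (mul_nonneg hC0 (A.diffMass_nonneg _ _ _ _ _))
        (absOverlap_le_one (hφn n) (hχn n))
    · have hj : rest.countP (fun s => !s.isQuery) = k := by
        simpa [List.countP_cons, hs] using hk
      refine le_trans ?_ (add_le_add (A.bhatt_cons_query x y s hs rest k φ χ)
        (mul_le_mul_of_nonneg_left (A.diffMass_cons_query x y s hs rest φ χ) hC0))
      rw [Finset.mul_sum, ← Finset.sum_add_distrib]
      refine Finset.sum_le_sum fun n _ => ?_
      rw [mul_left_comm C, ← mul_add]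
      refine mul_le_mul_of_nonneg_left ?_ (by positivity)
      have hφo := (A.sqNorm_oracle x _).trans_le (hφn n)
      have hχo := (A.sqNorm_oracle y _).trans_le (hχn n)
      have h := ih k hj _ _ hφo hχo hC
      have hd : 0 ≤ ∑ i with x i ≠ y i, √(A.addrMass (collapse s.label (s.U.1 *ᵥ φ) n) i) *
          √(A.addrMass (collapse s.label (s.U.1 *ᵥ χ) n) i) :=
        Finset.sum_nonneg fun _ _ => by positivity
      -- On $[0,1]$ the power $k+1$ is Lipschitz with constant $k+1$; with the factor $2$ from the
      -- oracle this is the requirement on `C`.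
      have h1 := pow_le_pow_add_mul (norm_nonneg _) (norm_overlap_le_one (hφn n) (hχn n))
        (norm_nonneg _) (norm_overlap_le_one hφo hχo) (by positivity)
        (A.norm_overlap_le_oracle x y _ _) (k + 1)
      have h2 := mul_le_mul_of_nonneg_right hC hd
      push_cast at h1
      linarith

end Algorithm

/-! ### Weight schemes and the weighted adversary bound -/

namespace WeightScheme

variable {N : ℕ} {D : Set (Input N)} {f : Input N → Bool} (S : WeightScheme D f)

lemma mem_of_mem_R {x y : Input N} (h : (x, y) ∈ S.R) : x ∈ S.X ∧ y ∈ S.Y :=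
  Finset.mem_product.1 (S.R_sub h)

lemma sum_R_eq_sum_X (g : Input N → Input N → ℝ) :
    ∑ p ∈ S.R, g p.1 p.2 = ∑ x ∈ S.X, ∑ y ∈ S.Y with (x, y) ∈ S.R, g x y := by
  simp only [Finset.sum_filter]
  rw [← Finset.sum_product', ← Finset.sum_filter]
  refine Finset.sum_congr ?_ fun _ _ => rfl
  ext p
  simp only [Finset.mem_filter]
  exact ⟨fun h => ⟨S.R_sub h, h⟩, fun h => h.2⟩

lemma sum_R_eq_sum_Y (g : Input N → Input N → ℝ) :
    ∑ p ∈ S.R, g p.1 p.2 = ∑ y ∈ S.Y, ∑ x ∈ S.X with (x, y) ∈ S.R, g x y := by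
  rw [sum_R_eq_sum_X]
  simp only [Finset.sum_filter]
  exact Finset.sum_comm

lemma wtX_nonneg (x : Input N) : 0 ≤ S.wtX x :=
  Finset.sum_nonneg fun y hy => (S.w_pos x y (Finset.mem_filter.1 hy).2).le

lemma wtY_nonneg (y : Input N) : 0 ≤ S.wtY y :=
  Finset.sum_nonneg fun x hx => (S.w_pos x y (Finset.mem_filter.1 hx).2).le

lemma wtX_pos {x y : Input N} (h : (x, y) ∈ S.R) : 0 < S.wtX x :=
  Finset.sum_pos (fun z hz => S.w_pos x z (Finset.mem_filter.1 hz).2)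
    ⟨y, Finset.mem_filter.2 ⟨(S.mem_of_mem_R h).2, h⟩⟩

lemma wtY_pos {x y : Input N} (h : (x, y) ∈ S.R) : 0 < S.wtY y :=
  Finset.sum_pos (fun z hz => S.w_pos z y (Finset.mem_filter.1 hz).2)
    ⟨x, Finset.mem_filter.2 ⟨(S.mem_of_mem_R h).1, h⟩⟩

lemma div_le_vX {x : Input N} (hx : x ∈ S.X) (i : Fin N) : S.loadX x i / S.wtX x ≤ S.vX :=
  le_ciSup (f := fun p : S.X × Fin N => S.loadX p.1 p.2 / S.wtX p.1)
    (Set.finite_range _).bddAbove (⟨x, hx⟩, i)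

lemma div_le_vY {y : Input N} (hy : y ∈ S.Y) (i : Fin N) : S.loadY y i / S.wtY y ≤ S.vY :=
  le_ciSup (f := fun p : S.Y × Fin N => S.loadY p.1 p.2 / S.wtY p.1)
    (Set.finite_range _).bddAbove (⟨y, hy⟩, i)

lemma loadX_le {x : Input N} (hx : x ∈ S.X) (i : Fin N) : S.loadX x i ≤ S.vX * S.wtX x := by
  by_cases h : ∃ y, (x, y) ∈ S.R
  · obtain ⟨y, hy⟩ := h
    exact (div_le_iff₀ (S.wtX_pos hy)).1 (S.div_le_vX hx i)
  · push Not at h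
    simp [loadX, wtX, h]

lemma loadY_le {y : Input N} (hy : y ∈ S.Y) (i : Fin N) : S.loadY y i ≤ S.vY * S.wtY y := by
  by_cases h : ∃ x, (x, y) ∈ S.R
  · obtain ⟨x, hx⟩ := h
    exact (div_le_iff₀ (S.wtY_pos hx)).1 (S.div_le_vY hy i)
  · push Not at h
    simp [loadY, wtY, h]

lemma exists_ne_of_mem_R {x y : Input N} (h : (x, y) ∈ S.R) : ∃ i, x i ≠ y i := by
  by_contra! hxy
  obtain rfl : x = y := funext hxy
  have h0 := (S.X_sub x (S.mem_of_mem_R h).1).2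
  have h1 := (S.Y_sub x (S.mem_of_mem_R h).2).2
  simp [h0] at h1

/-- A related pair has different values of $f$, hence differs at some index, and there the load is a
non-empty sum of positive weights. -/
lemma vX_pos (hR : S.R.Nonempty) : 0 < S.vX := by
  obtain ⟨⟨x, y⟩, h⟩ := hR
  obtain ⟨i, hi⟩ := S.exists_ne_of_mem_R h
  refine (div_pos ?_ (S.wtX_pos h)).trans_le (S.div_le_vX (S.mem_of_mem_R h).1 i)
  refine Finset.sum_pos (fun z hz => ?_) ⟨y, Finset.mem_filter.2 ⟨(S.mem_of_mem_R h).2, h, hi⟩⟩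
  obtain ⟨-, hz, hzi⟩ := Finset.mem_filter.1 hz
  exact S.w'_pos_left x z hz i hzi

lemma vY_pos (hR : S.R.Nonempty) : 0 < S.vY := by
  obtain ⟨⟨x, y⟩, h⟩ := hR
  obtain ⟨i, hi⟩ := S.exists_ne_of_mem_R h
  refine (div_pos ?_ (S.wtY_pos h)).trans_le (S.div_le_vY (S.mem_of_mem_R h).2 i)
  refine Finset.sum_pos (fun z hz => ?_) ⟨x, Finset.mem_filter.2 ⟨(S.mem_of_mem_R h).1, h, hi⟩⟩
  obtain ⟨-, hz, hzi⟩ := Finset.mem_filter.1 hz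
  exact S.w'_pos_right z y hz i hzi

lemma vmax_pos (hR : S.R.Nonempty) : 0 < S.vmax :=
  Real.sqrt_pos.2 (mul_pos (S.vX_pos hR) (S.vY_pos hR))

/-- The total weight of the relation. -/
def totalWeight : ℝ := ∑ p ∈ S.R, S.w p.1 p.2

lemma totalWeight_pos (hR : S.R.Nonempty) : 0 < S.totalWeight :=
  Finset.sum_pos (fun p hp => S.w_pos p.1 p.2 hp) hR

/-- Summing over $y$ first turns the weights $w'$ into loads, each at most $v_X\,wt(x)$; the weights
$wt(x)$ then add up to the total weight. -/
lemma sum_w'_left_le (hR : S.R.Nonempty) {T : Input N → Fin N → ℝ} (hT : ∀ x i, 0 ≤ T x i) {q : ℝ}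
    (hq : ∀ x, ∑ i, T x i ≤ q) :
    ∑ p ∈ S.R, ∑ i with p.1 i ≠ p.2 i, S.w' p.1 p.2 i * T p.1 i ≤ q * S.vX * S.totalWeight := by
  rw [S.sum_R_eq_sum_X fun x y => ∑ i with x i ≠ y i, S.w' x y i * T x i, totalWeight,
    S.sum_R_eq_sum_X S.w, Finset.mul_sum]
  refine Finset.sum_le_sum fun x hx => ?_
  have h : ∑ y ∈ S.Y with (x, y) ∈ S.R, ∑ i with x i ≠ y i, S.w' x y i * T x i =
      ∑ i, S.loadX x i * T x i := by
    simp only [loadX, Finset.sum_filter, Finset.sum_mul, ite_and]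
    rw [Finset.sum_comm]
    refine Finset.sum_congr rfl fun y _ => ?_
    split_ifs <;> simp [ite_mul]
  rw [h]
  calc ∑ i, S.loadX x i * T x i ≤ ∑ i, S.vX * S.wtX x * T x i :=
        Finset.sum_le_sum fun i _ => mul_le_mul_of_nonneg_right (S.loadX_le hx i) (hT x i)
    _ = S.vX * S.wtX x * ∑ i, T x i := by rw [Finset.mul_sum]
    _ ≤ S.vX * S.wtX x * q :=
        mul_le_mul_of_nonneg_left (hq x) (mul_nonneg (S.vX_pos hR).le (S.wtX_nonneg x))
    _ = q * S.vX * S.wtX x := by ring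

lemma sum_w'_right_le (hR : S.R.Nonempty) {T : Input N → Fin N → ℝ} (hT : ∀ x i, 0 ≤ T x i)
    {q : ℝ} (hq : ∀ x, ∑ i, T x i ≤ q) :
    ∑ p ∈ S.R, ∑ i with p.1 i ≠ p.2 i, S.w' p.2 p.1 i * T p.2 i ≤ q * S.vY * S.totalWeight := by
  rw [S.sum_R_eq_sum_Y fun x y => ∑ i with x i ≠ y i, S.w' y x i * T y i, totalWeight,
    S.sum_R_eq_sum_Y S.w, Finset.mul_sum]
  refine Finset.sum_le_sum fun y hy => ?_
  have h : ∑ x ∈ S.X with (x, y) ∈ S.R, ∑ i with x i ≠ y i, S.w' y x i * T y i =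
      ∑ i, S.loadY y i * T y i := by
    simp only [loadY, Finset.sum_filter, Finset.sum_mul, ite_and]
    rw [Finset.sum_comm]
    refine Finset.sum_congr rfl fun x _ => ?_
    split_ifs <;> simp [ite_mul]
  rw [h]
  calc ∑ i, S.loadY y i * T y i ≤ ∑ i, S.vY * S.wtY y * T y i :=
        Finset.sum_le_sum fun i _ => mul_le_mul_of_nonneg_right (S.loadY_le hy i) (hT y i)
    _ = S.vY * S.wtY y * ∑ i, T y i := by rw [Finset.mul_sum]
    _ ≤ S.vY * S.wtY y * q :=
        mul_le_mul_of_nonneg_left (hq y) (mul_nonneg (S.vY_pos hR).le (S.wtY_nonneg y))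
    _ = q * S.vY * S.wtY y := by ring

/-- The weighted adversary bound for query masses `T x i` of total at most `q` per input. -/
lemma sum_w_mul_sqrt_le (hR : S.R.Nonempty) {T : Input N → Fin N → ℝ} (hT : ∀ x i, 0 ≤ T x i)
    {q : ℝ} (hq0 : 0 ≤ q) (hq : ∀ x, ∑ i, T x i ≤ q) :
    ∑ p ∈ S.R, S.w p.1 p.2 * ∑ i with p.1 i ≠ p.2 i, √(T p.1 i) * √(T p.2 i) ≤
      q * S.vmax * S.totalWeight := by
  have hW := (S.totalWeight_pos hR).le
  have hX := (S.vX_pos hR).le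
  calc ∑ p ∈ S.R, S.w p.1 p.2 * ∑ i with p.1 i ≠ p.2 i, √(T p.1 i) * √(T p.2 i)
      ≤ ∑ p ∈ S.R, √(∑ i with p.1 i ≠ p.2 i, S.w' p.1 p.2 i * T p.1 i) *
          √(∑ i with p.1 i ≠ p.2 i, S.w' p.2 p.1 i * T p.2 i) := by
        refine Finset.sum_le_sum fun p hp => ?_
        rw [Finset.mul_sum]
        -- The condition on the scheme gives $w\le\sqrt{w'(x,y,i)\,w'(y,x,i)}$, so $w$ can be shared
        -- between the two factors before Cauchy–Schwarz over $i$.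
        refine le_trans (Finset.sum_le_sum fun i hi => ?_) (Real.sum_mul_le_sqrt_mul_sqrt _
          (fun i => √(S.w' p.1 p.2 i * T p.1 i)) (fun i => √(S.w' p.2 p.1 i * T p.2 i))) |>.trans_eq
          ?_
        · have hi' := (Finset.mem_filter.1 hi).2
          have hl := (S.w'_pos_left _ _ hp i hi').le
          have hr := (S.w'_pos_right _ _ hp i hi').le
          rw [Real.sqrt_mul hl, Real.sqrt_mul hr, mul_mul_mul_comm, ← Real.sqrt_mul hl]
          refine mul_le_mul_of_nonneg_right (Real.le_sqrt_of_sq_le (S.w'_mul _ _ hp i hi'))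
            (by positivity)
        · congr 2 <;> refine Finset.sum_congr rfl fun i hi => Real.sq_sqrt ?_
          · exact mul_nonneg (S.w'_pos_left _ _ hp i (Finset.mem_filter.1 hi).2).le (hT _ _)
          · exact mul_nonneg (S.w'_pos_right _ _ hp i (Finset.mem_filter.1 hi).2).le (hT _ _)
    _ ≤ √(∑ p ∈ S.R, ∑ i with p.1 i ≠ p.2 i, S.w' p.1 p.2 i * T p.1 i) *
          √(∑ p ∈ S.R, ∑ i with p.1 i ≠ p.2 i, S.w' p.2 p.1 i * T p.2 i) := by
        refine (Real.sum_mul_le_sqrt_mul_sqrt _ _ _).trans_eq ?_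
        congr 2 <;> refine Finset.sum_congr rfl fun p hp => Real.sq_sqrt
          (Finset.sum_nonneg fun i hi => ?_)
        · exact mul_nonneg (S.w'_pos_left _ _ hp i (Finset.mem_filter.1 hi).2).le (hT _ _)
        · exact mul_nonneg (S.w'_pos_right _ _ hp i (Finset.mem_filter.1 hi).2).le (hT _ _)
    _ ≤ √(q * S.vX * S.totalWeight) * √(q * S.vY * S.totalWeight) := by
        gcongr
        · exact S.sum_w'_left_le hR hT hq
        · exact S.sum_w'_right_le hR hT hq
    _ = √((q * S.totalWeight) ^ 2 * (S.vX * S.vY)) := by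
        rw [← Real.sqrt_mul (by positivity)]
        congr 1
        ring
    _ = q * S.vmax * S.totalWeight := by
        rw [Real.sqrt_mul (by positivity), Real.sqrt_sq (by positivity), vmax]
        ring

end WeightScheme

/-! ### From correctness to the lower bound -/

namespace Algorithm

variable {B : Type} [Fintype B] [DecidableEq B] {N : ℕ} (A : Algorithm N B)

lemma sqNorm_single (b : B) : sqNorm (Pi.single b 1 : B → ℂ) = 1 := by
  simp [sqNorm, Pi.single_apply, apply_ite]

lemma answerProb_add_answerProb_not_le_one (x : Input N) (a : Bool) :
    A.answerProb x a + A.answerProb x (!a) ≤ 1 := by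
  have h := A.sum_outProb_le_one x A.steps A.numMeasurements rfl (Pi.single A.init 1)
    (sqNorm_single _).le
  rw [← Finset.sum_filter_add_sum_filter_not _ (fun v => A.output (List.ofFn v) = a)] at h
  simpa [answerProb, Bool.eq_not] using h

lemma answerProb_nonneg (x : Input N) (a : Bool) : 0 ≤ A.answerProb x a :=
  Finset.sum_nonneg fun _ _ => A.outProb_nonneg _ _ _ _

lemma bhatt_le_answerProb (x y : Input N) :
    A.bhatt x y A.steps A.numMeasurements (Pi.single A.init 1) (Pi.single A.init 1) ≤
      √(A.answerProb x false) * √(A.answerProb y false) +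
        √(A.answerProb x true) * √(A.answerProb y true) := by
  rw [bhatt, ← Finset.sum_filter_add_sum_filter_not _ (fun v => A.output (List.ofFn v) = false)]
  simp only [Bool.not_eq_false]
  exact add_le_add
    (Real.sum_sqrt_mul_sqrt_le _ (fun _ => A.outProb_nonneg _ _ _ _)
      (fun _ => A.outProb_nonneg _ _ _ _))
    (Real.sum_sqrt_mul_sqrt_le _ (fun _ => A.outProb_nonneg _ _ _ _)
      (fun _ => A.outProb_nonneg _ _ _ _))

lemma bhatt_le_of_computes {D : Set (Input N)} {f : Input N → Bool} {ε : ℝ}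
    (hε : ε < 1 / 2) (hA : A.Computes D f ε) {x y : Input N} (hx : x ∈ D) (hy : y ∈ D)
    (hfx : f x = false) (hfy : f y = true) :
    A.bhatt x y A.steps A.numMeasurements (Pi.single A.init 1) (Pi.single A.init 1) ≤
      2 * √(ε * (1 - ε)) := by
  have hp := hA x hx
  have hq := hA y hy
  rw [hfx] at hp
  rw [hfy] at hq
  have hp1 := A.answerProb_add_answerProb_not_le_one x false
  have hq1 := A.answerProb_add_answerProb_not_le_one y true
  have hx1 := A.answerProb_nonneg x true
  have hy0 := A.answerProb_nonneg y false
  simp only [Bool.not_false, Bool.not_true] at hp1 hq1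
  refine (A.bhatt_le_answerProb x y).trans ?_
  -- Swapped so that Cauchy–Schwarz groups the two correct answers in one factor and the two wrong
  -- ones in the other.
  rw [mul_comm (√(A.answerProb x true))]
  refine (sqrt_mul_sqrt_add_le (by linarith) hy0 (by linarith) hx1).trans ?_
  rw [← Real.sqrt_mul (by linarith)]
  have h4 : 2 * √(ε * (1 - ε)) = √(4 * (ε * (1 - ε))) := by
    rw [show (4 : ℝ) = 2 ^ 2 by norm_num, Real.sqrt_mul (sq_nonneg 2), Real.sqrt_sq zero_le_two]
  rw [h4]
  refine Real.sqrt_le_sqrt ?_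
  set s := A.answerProb x false + A.answerProb y true with hs
  have h1 : s * (A.answerProb y false + A.answerProb x true) ≤ s * (2 - s) :=
    mul_le_mul_of_nonneg_left (by linarith) (by linarith)
  -- Expanded, this is $s(2-s)\le4\varepsilon(1-\varepsilon)$; both factors are nonnegative because
  -- $s\ge2(1-\varepsilon)>2\varepsilon$.
  have h2 : 0 ≤ (s - 2 * (1 - ε)) * (s - 2 * ε) := mul_nonneg (by linarith) (by linarith)
  linarith

/-- Without samples the answer is the constant `A.output []`, which cannot equal both values of $f$.
-/
lemma numMeasurements_pos {D : Set (Input N)} {f : Input N → Bool} {ε : ℝ}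
    (hε : ε < 1 / 2) (hA : A.Computes D f ε) {x y : Input N} (hx : x ∈ D) (hy : y ∈ D)
    (hfx : f x = false) (hfy : f y = true) : 0 < A.numMeasurements := by
  by_contra! h0
  have h0 : A.numMeasurements = 0 := by omega
  have key : ∀ z ∈ D, A.output [] = f z := by
    intro z hz
    by_contra hne
    have h := hA z hz
    rw [answerProb, Finset.sum_eq_zero] at h
    · linarith
    · intro v hv
      have hnil : List.ofFn v = [] := List.length_eq_zero_iff.1 (by simp [h0])
      exact absurd (hnil ▸ (Finset.mem_filter.1 hv).2) hne
  have := (key x hx).symm.trans (key y hy)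
  simp [hfx, hfy] at this

/-- The lower bound on the query mass that separates an input pair with different values. -/
lemma one_sub_le_diffMass {D : Set (Input N)} {f : Input N → Bool} {ε : ℝ}
    (hε : ε < 1 / 2) (hA : A.Computes D f ε) {x y : Input N} (hx : x ∈ D) (hy : y ∈ D)
    (hfx : f x = false) (hfy : f y = true) :
    1 - 2 * √(ε * (1 - ε)) ≤ 2 * ((A.numMeasurements : ℝ) + 1) *
      A.diffMass x y A.steps (Pi.single A.init 1) (Pi.single A.init 1) := by
  have h := A.norm_overlap_pow_le_bhatt x y A.steps A.numMeasurements rfl (Pi.single A.init 1)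
    (Pi.single A.init 1) (sqNorm_single _).le (sqNorm_single _).le _ le_rfl
  rw [overlap_self, sqNorm_single, Complex.ofReal_one, norm_one, one_pow] at h
  linarith [A.bhatt_le_of_computes hε hA hx hy hfx hfy]

lemma one_sub_le_mul_vmax {D : Set (Input N)} {f : Input N → Bool} (S : WeightScheme D f)
    (hR : S.R.Nonempty) {ε : ℝ} (hε : ε < 1 / 2) (hA : A.Computes D f ε) :
    1 - 2 * √(ε * (1 - ε)) ≤
      2 * ((A.numMeasurements : ℝ) + 1) * (A.numQueries * S.vmax) := by
  have hW := S.totalWeight_pos hR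
  have hsum := S.sum_w_mul_sqrt_le hR
    (T := fun x i => A.queryMass x i A.steps (Pi.single A.init 1))
    (fun x i => A.queryMass_nonneg _ _ _ _) (Nat.cast_nonneg A.numQueries)
    (fun x => A.sum_queryMass_le x A.steps _ (sqNorm_single _).le)
  refine le_of_mul_le_mul_left ?_ hW
  calc S.totalWeight * (1 - 2 * √(ε * (1 - ε)))
      = ∑ p ∈ S.R, S.w p.1 p.2 * (1 - 2 * √(ε * (1 - ε))) := by
        rw [WeightScheme.totalWeight, Finset.sum_mul]
    _ ≤ ∑ p ∈ S.R, S.w p.1 p.2 * (2 * ((A.numMeasurements : ℝ) + 1) *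
          A.diffMass p.1 p.2 A.steps (Pi.single A.init 1) (Pi.single A.init 1)) := by
        refine Finset.sum_le_sum fun p hp => mul_le_mul_of_nonneg_left ?_ (S.w_pos _ _ hp).le
        obtain ⟨hx, hy⟩ := S.mem_of_mem_R hp
        exact A.one_sub_le_diffMass hε hA (S.X_sub _ hx).1 (S.Y_sub _ hy).1 (S.X_sub _ hx).2
          (S.Y_sub _ hy).2
    _ = 2 * ((A.numMeasurements : ℝ) + 1) * ∑ p ∈ S.R, S.w p.1 p.2 *
          A.diffMass p.1 p.2 A.steps (Pi.single A.init 1) (Pi.single A.init 1) := by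
        rw [Finset.mul_sum]
        exact Finset.sum_congr rfl fun p _ => by ring
    _ ≤ 2 * ((A.numMeasurements : ℝ) + 1) * (A.numQueries * S.vmax * S.totalWeight) :=
        mul_le_mul_of_nonneg_left hsum (by positivity)
    _ = _ := by ring

end Algorithm

end PDQP

end

theorem mainTheorem1 :
    ∃ c : ℝ, 0 < c ∧
      ∀ (N : ℕ) (D : Set (PDQP.Input N)) (f : PDQP.Input N → Bool)
        (S : PDQP.WeightScheme D f), S.R.Nonempty →
        0 < S.vmax ∧
        ∀ (B : Type) [Fintype B] [DecidableEq B] (A : PDQP.Algorithm N B) (ε : ℝ),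
          0 ≤ ε → ε < 1 / 2 → A.Computes D f ε →
          c * (1 - 2 * √(ε * (1 - ε))) / S.vmax ≤
            (A.numQueries : ℝ) * (A.numMeasurements : ℝ) := by
  -- The bound obtained has the factor $2(P+1)$, which is at most $4P$ since $P\ge1$.
  refine ⟨1 / 4, by norm_num, fun N D f S hR => ⟨S.vmax_pos hR, ?_⟩⟩
  intro B _ _ A ε _ hε hA
  have hv := S.vmax_pos hR
  have hmain := A.one_sub_le_mul_vmax S hR hε hA
  obtain ⟨p, hp⟩ := hR
  obtain ⟨hx, hy⟩ := S.mem_of_mem_R hp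
  have hP : (1 : ℝ) ≤ A.numMeasurements := by
    exact_mod_cast A.numMeasurements_pos hε hA (S.X_sub _ hx).1 (S.Y_sub _ hy).1 (S.X_sub _ hx).2
      (S.Y_sub _ hy).2
  have hQ : 0 ≤ (A.numQueries : ℝ) * S.vmax := by positivity
  rw [div_le_iff₀ hv]
  nlinarith [mul_le_mul_of_nonneg_right hP hQ]
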